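/- **Theorem 3.3 (Criteria for the four cases).** For $m\ge 0$ let $\nu(m)$ be the $2$-adic valuation of $m$ (with $\nu(0)=\infty$), $\sigma(m)$ the sum of the base two digits of $m$, and $[m]$ the set of powers of two occurring in the base two expansion of $m$; the exponents of these powers are called the exponents in $[m]$. A carry in the base two addition $a+b$ is *forced* if both digits in its place are $1$, and *unforced* otherwise; "$a+b$ has no unforced carries" refers to the addition of the two numbers $a,b\ge 0$. Let $1\le k\le n$ be integers and let $S(n,k)$ be the Stirling number of the second kind. We say that $S(n,k)$ is * a *minimum zero case* (MZC) if $\nu(S(n,k))=\sigma(k)-\sigma(n)$; * a *shifted minimum zero case* (SMZC) if $\nu(S(n,k))=\sigma(k-1)-\sigma(n-1)$; * an *almost minimum zero case* (AMZC) if $\nu(S(n,k))=\sigma(k)-\sigma(n)+\#([n]\cap[n-k])$ and $S(n,k)$ is not a MZC; * a *shifted almost minimum zero case* (SAMZC) if $\nu(S(n,k))=\sigma(k-1)-\sigma(n-1)+\#([n-1]\cap[n-k])$ and $S(n,k)$ is not a SMZC. Then: (i) $S(n,k)$ is a MZC iff $[n-k]\cap[n]=\emptyset$. (ii) $S(n,k)$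 is a SMZC iff $[n-k]\cap[n-1]=\emptyset$. (iii) $S(n,k)$ is an AMZC iff $[n-k]\cap[n]\neq\emptyset$ and precisely one of the following conditions holds: * (a) $\nu\binom{n+(n-k)}{n}=\#([n]\cap[n-k])$; equivalently, $n+(n-k)$ has no unforced carries. * (b) $\nu\binom{n+(n-k)-1}{n}=\#([n]\cap[n-k])-1$; equivalently, $\nu(n)=\nu(n-k)$ and $n+(n-k-1)$ has no unforced carries. * (c) $n-k$ is odd and $\nu\binom{n+(n-k)-2}{n}=\#([n]\cap[n-k])-1$; equivalently, $n-k$ is odd, $[n]$ and $[n-k]$ both have a positive exponent, the least positive exponent in $[n]$ is the same as that in $[n-k]$, and $n+(n-k-2)$ has no unforced carries. (iv) $S(n,k)$ is a SAMZC iff $[n-k]\cap[n-1]\neq\emptyset$ and precisely one of the following conditions holds: * (a) $\nu\binom{n-1+(n-k)}{n-1}=\#([n-1]\cap[n-k])$; equivalently, $(n-1)+(n-k)$ has no unforced carries. * (b) $n-k$ is odd and $\nu\binom{n-1+(n-k)-2}{n-1}=\#([n-1]\cap[n-k])-1$; equivalently, $n-k$ is odd, $[n-1]$ and $[n-k]$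 both have a positive exponent, the least positive exponent in $[n-1]$ is the same as that in $[n-k]$, and $(n-1)+(n-k-2)$ has no unforced carries. -/

import Mathlib

namespace StirlingTwo

/-- The `2`-adic valuation of a natural number, with `ν(0) = ∞`. -/
def nu (m : ℕ) : WithTop ℤ :=
  if m = 0 then ⊤ else (((padicValNat 2 m : ℕ) : ℤ) : WithTop ℤ)

/-- `σ(m)`: the sum of the base two digits of `m`, as an integer. -/
def sigma (m : ℕ) : ℤ := (((Nat.digits 2 m).sum : ℕ) : ℤ)

/-- `[m]`: the set of powers of two that occur in the base two expansion of `m`. -/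
def pows (m : ℕ) : Finset ℕ :=
  ((Finset.range m).filter (fun i => m.testBit i = true)).image (fun i => 2 ^ i)

/-- The bound `i < m` in the definition of `[m]` loses nothing. -/
theorem mem_pows (m p : ℕ) : p ∈ pows m ↔ ∃ i, m.testBit i = true ∧ 2 ^ i = p := by
  simp only [pows, Finset.mem_image, Finset.mem_filter, Finset.mem_range]
  constructor
  · rintro ⟨i, ⟨_, h⟩, rfl⟩
    exact ⟨i, h, rfl⟩
  · rintro ⟨i, h, rfl⟩
    exact ⟨i, ⟨lt_of_lt_of_le Nat.lt_two_pow_self (Nat.ge_two_pow_of_testBit h), h⟩, rfl⟩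

/-- `#([a] ∩ [b])`, the number of common `2`-powers of `a` and `b`, as an integer. -/
def common (a b : ℕ) : ℤ := (((pows a ∩ pows b).card : ℕ) : ℤ)

/-- There is a carry out of place `i` in the base two addition `a + b`. -/
def Carry (a b : ℕ) : ℕ → Prop
  | 0 => a.testBit 0 = true ∧ b.testBit 0 = true
  | i + 1 => (a.testBit (i + 1) = true ∧ b.testBit (i + 1) = true) ∨
      (a.testBit (i + 1) ≠ b.testBit (i + 1) ∧ Carry a b i)

/-- A carry is forced if both digits in its place are `1`; the addition `a + b` has no
unforced carries if all its carries are forced. -/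
def NoUnforcedCarries (a b : ℕ) : Prop :=
  ∀ i, Carry a b i → a.testBit i = true ∧ b.testBit i = true

/-- `e` is the least positive exponent in `[m]`. -/
def IsLeastPosExponent (m e : ℕ) : Prop :=
  IsLeast {i : ℕ | 0 < i ∧ 2 ^ i ∈ pows m} e

/-- `[a]` and `[b]` have a least positive exponent, and it is the same for both. -/
def SameLeastPosExponent (a b : ℕ) : Prop :=
  ∃ e, IsLeastPosExponent a e ∧ IsLeastPosExponent b e

/-- Minimum zero case: the estimate `ν(S(n,k)) ≥ σ(k) - σ(n)` is sharp. -/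
def IsMZC (n k : ℕ) : Prop :=
  nu (Nat.stirlingSecond n k) = ((sigma k - sigma n : ℤ) : WithTop ℤ)

/-- Shifted minimum zero case: the estimate `ν(S(n,k)) ≥ σ(k-1) - σ(n-1)` is sharp. -/
def IsSMZC (n k : ℕ) : Prop :=
  nu (Nat.stirlingSecond n k) = ((sigma (k - 1) - sigma (n - 1) : ℤ) : WithTop ℤ)

/-- Almost minimum zero case: the estimate `ν(S(n,k)) ≥ σ(k) - σ(n) + #([n] ∩ [n-k])` is sharp,
but this is not a minimum zero case. -/
def IsAMZC (n k : ℕ) : Prop :=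
  nu (Nat.stirlingSecond n k) =
    ((sigma k - sigma n + common n (n - k) : ℤ) : WithTop ℤ) ∧ ¬ IsMZC n k

/-- Shifted almost minimum zero case: the estimate
`ν(S(n,k)) ≥ σ(k-1) - σ(n-1) + #([n-1] ∩ [n-k])` is sharp, but this is not a shifted minimum
zero case. -/
def IsSAMZC (n k : ℕ) : Prop :=
  nu (Nat.stirlingSecond n k) =
    ((sigma (k - 1) - sigma (n - 1) + common (n - 1) (n - k) : ℤ) : WithTop ℤ) ∧ ¬ IsSMZC n k

/-- `ν(binom(n+n-k, n)) = #([n] ∩ [n-k])`. -/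
def CondA (n k : ℕ) : Prop :=
  nu (Nat.choose (n + (n - k)) n) = ((common n (n - k) : ℤ) : WithTop ℤ)

/-- `ν(binom(n+n-k-1, n)) = #([n] ∩ [n-k]) - 1`. -/
def CondB (n k : ℕ) : Prop :=
  nu (Nat.choose (n + (n - k) - 1) n) = ((common n (n - k) - 1 : ℤ) : WithTop ℤ)

/-- `n-k` is odd and `ν(binom(n+n-k-2, n)) = #([n] ∩ [n-k]) - 1`. -/
def CondC (n k : ℕ) : Prop :=
  Odd (n - k) ∧
    nu (Nat.choose (n + (n - k) - 2) n) = ((common n (n - k) - 1 : ℤ) : WithTop ℤ)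

/-- `ν(binom(n-1+n-k, n-1)) = #([n-1] ∩ [n-k])`. -/
def ShiftedCondA (n k : ℕ) : Prop :=
  nu (Nat.choose (n - 1 + (n - k)) (n - 1)) = ((common (n - 1) (n - k) : ℤ) : WithTop ℤ)

/-- `n-k` is odd and `ν(binom(n-1+n-k-2, n-1)) = #([n-1] ∩ [n-k]) - 1`. -/
def ShiftedCondB (n k : ℕ) : Prop :=
  Odd (n - k) ∧
    nu (Nat.choose (n - 1 + (n - k) - 2) (n - 1)) =
      ((common (n - 1) (n - k) - 1 : ℤ) : WithTop ℤ)

/-- Precisely one of three propositions holds. -/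
def ExactlyOne (p q r : Prop) : Prop :=
  (p ∧ ¬ q ∧ ¬ r) ∨ (¬ p ∧ q ∧ ¬ r) ∨ (¬ p ∧ ¬ q ∧ r)

end StirlingTwo

open StirlingTwo

/-! Put m = n - k and L = log(1+2X)/(2X), a power series over `ℤ_[2]` with constant term 1. In the
spirit of Lagrange inversion for e^x - 1, k! 2^m S(n,k) = n! [X^m] L^(-n-1)/(1+2X) and (k-1)! 2^m
S(n,k) = (n-1)! [X^m] L^(-n) (`stirlingSecond_mul_eq_coeff_geom`,
`stirlingSecond_mul_eq_coeff_pow`). By Legendre's formula ν(N!) = N - σ(N), the valuations of these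
coefficients are the excesses of ν(S(n,k)) over σ(k) - σ(n) and σ(k-1) - σ(n-1).

Write L = 1 - XT and expand L^(-n-1) = ∑ binom(n+p,n) X^p T^p. By Kummer's theorem 2^#([n]∩[p])
divides binom(n+p,n), and # grows by at most σ(q) when p becomes p+q. With c = #([n]∩[m]), errors
whose X^i coefficient is divisible by 2^(σ(i)+1) therefore vanish modulo 2^(c+1)
(`two_pow_dvd_sum_choose`). Up to such errors T^p is 1 + 2pX^2 and 1/(1+2X) is 1 + 2X. There remain
binom(n+m,n), 2 binom(n+m-1,n) and 2(m-2) binom(n+m-2,n); the second is absent in the shifted case,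
where n-1 replaces n.

Each of these is divisible by 2^c, and (a), (b), (c) say that the respective one is not divisible by
2^(c+1). The valuation is c iff an odd number of them hold; as (b) and (c) are incompatible, this
means exactly one. Modulo 2 only the first term counts, which settles (i) and (ii). -/

namespace StirlingTwo

/-! ### Binary digits, common powers and carries -/

/-- The sum of the binary digits, as a natural number. -/
def digitSum (m : ℕ) : ℕ := (Nat.digits 2 m).sum

/-- The number of common binary powers, as a natural number. -/
def commonCard (a b : ℕ) : ℕ := (pows a ∩ pows b).card

theorem exists_two_mul_add (a : ℕ) : ∃ q r, r < 2 ∧ a = 2 * q + r :=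
  ⟨a / 2, a % 2, Nat.mod_lt _ two_pos, (Nat.div_add_mod a 2).symm⟩

@[simp] theorem digitSum_zero : digitSum 0 = 0 := by simp [digitSum]

theorem digitSum_two_mul_add (a : ℕ) {r : ℕ} (hr : r < 2) :
    digitSum (2 * a + r) = digitSum a + r := by
  rcases Nat.eq_zero_or_pos (2 * a + r) with h | h
  · obtain ⟨rfl, rfl⟩ : a = 0 ∧ r = 0 := by omega
    simp
  · rw [digitSum, Nat.digits_def' one_lt_two h, List.sum_cons, digitSum]
    have h1 : (2 * a + r) % 2 = r := by omega
    have h2 : (2 * a + r) / 2 = a := by omega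
    rw [h1, h2, add_comm]

theorem testBit_two_mul_add_zero (a : ℕ) {r : ℕ} (hr : r < 2) :
    (2 * a + r).testBit 0 = true ↔ r = 1 := by
  rw [Nat.testBit_zero, decide_eq_true_iff]; omega

theorem testBit_two_mul_add_succ (a i : ℕ) {r : ℕ} (hr : r < 2) :
    (2 * a + r).testBit (i + 1) = a.testBit i := by
  rw [Nat.testBit_add_one]; congr 1; omega

theorem mem_pows_two_mul_add (a p : ℕ) {r : ℕ} (hr : r < 2) :
    p ∈ pows (2 * a + r) ↔ (r = 1 ∧ p = 1) ∨ ∃ q ∈ pows a, 2 * q = p := by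
  simp only [mem_pows]
  constructor
  · rintro ⟨i, hi, rfl⟩
    cases i with
    | zero => exact Or.inl ⟨(testBit_two_mul_add_zero a hr).1 hi, rfl⟩
    | succ i =>
      rw [testBit_two_mul_add_succ a i hr] at hi
      exact Or.inr ⟨2 ^ i, ⟨i, hi, rfl⟩, (pow_succ' 2 i).symm⟩
  · rintro (⟨h, rfl⟩ | ⟨q, ⟨i, hi, rfl⟩, rfl⟩)
    · exact ⟨0, (testBit_two_mul_add_zero a hr).2 h, rfl⟩
    · exact ⟨i + 1, by rwa [testBit_two_mul_add_succ a i hr], pow_succ' 2 i⟩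

@[simp] theorem pows_zero : pows 0 = ∅ := by simp [pows]

@[simp] theorem commonCard_zero_left (a : ℕ) : commonCard 0 a = 0 := by simp [commonCard]

@[simp] theorem commonCard_zero_right (a : ℕ) : commonCard a 0 = 0 := by simp [commonCard]

theorem commonCard_two_mul_add (a b : ℕ) {r s : ℕ} (hr : r < 2) (hs : s < 2) :
    commonCard (2 * a + r) (2 * b + s) = commonCard a b + r * s := by
  have hinj : Function.Injective (fun q : ℕ => 2 * q) := fun x y h => by simpa using h
  have key : pows (2 * a + r) ∩ pows (2 * b + s) =
      (if r * s = 1 then {1} else ∅) ∪ (pows a ∩ pows b).image (fun q => 2 * q) := by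
    ext p
    rw [Finset.mem_inter, mem_pows_two_mul_add a p hr, mem_pows_two_mul_add b p hs,
      Finset.mem_union, Finset.mem_image]
    have h1 : p ∈ (if r * s = 1 then ({1} : Finset ℕ) else ∅) ↔ (r = 1 ∧ s = 1) ∧ p = 1 := by
      split_ifs with h
      · simp [Nat.eq_one_of_mul_eq_one_right h, Nat.eq_one_of_mul_eq_one_left h]
      · simp only [Finset.notMem_empty, false_iff]
        rintro ⟨⟨rfl, rfl⟩, -⟩
        exact h rfl
    rw [h1]
    constructor
    · rintro ⟨⟨h1, h2⟩ | ⟨q, hq, h2⟩, ⟨h3, h4⟩ | ⟨q', hq', h4⟩⟩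
      · exact Or.inl ⟨⟨h1, h3⟩, h2⟩
      · omega
      · omega
      · obtain rfl : q = q' := by omega
        exact Or.inr ⟨q, Finset.mem_inter.2 ⟨hq, hq'⟩, h2⟩
    · rintro (⟨⟨h1, h2⟩, h3⟩ | ⟨q, hq, h⟩)
      · exact ⟨Or.inl ⟨h1, h3⟩, Or.inl ⟨h2, h3⟩⟩
      · exact ⟨Or.inr ⟨q, (Finset.mem_inter.1 hq).1, h⟩, Or.inr ⟨q, (Finset.mem_inter.1 hq).2, h⟩⟩
  rw [commonCard, key, Finset.card_union_of_disjoint, Finset.card_image_of_injective _ hinj,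
    commonCard, add_comm]
  · congr 1
    interval_cases r <;> interval_cases s <;> simp
  · rw [Finset.disjoint_left]
    intro p hp hp'
    obtain ⟨q, -, hq⟩ := Finset.mem_image.1 hp'
    split_ifs at hp
    · rw [Finset.mem_singleton] at hp
      omega
    · simp at hp

/-- `Carry`, with a carry-in into place `0` if `P` holds. -/
def CarryFrom (P : Prop) (a b : ℕ) : ℕ → Prop
  | 0 => (a.testBit 0 = true ∧ b.testBit 0 = true) ∨ (a.testBit 0 ≠ b.testBit 0 ∧ P)
  | i + 1 => (a.testBit (i + 1) = true ∧ b.testBit (i + 1) = true) ∨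
      (a.testBit (i + 1) ≠ b.testBit (i + 1) ∧ CarryFrom P a b i)

theorem carryFrom_succ (P : Prop) (a b i : ℕ) : CarryFrom P a b (i + 1) ↔
    (a.testBit (i + 1) = true ∧ b.testBit (i + 1) = true) ∨
      (a.testBit (i + 1) ≠ b.testBit (i + 1) ∧ CarryFrom P a b i) := Iff.rfl

theorem carry_iff_carryFrom (a b i : ℕ) : Carry a b i ↔ CarryFrom False a b i := by
  induction i with
  | zero => simp [Carry, CarryFrom]
  | succ i ih => simp only [Carry, CarryFrom, ih]

theorem carryFrom_two_mul_add_zero (P : Prop) (a b : ℕ) {r s : ℕ} (hr : r < 2) (hs : s < 2) :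
    CarryFrom P (2 * a + r) (2 * b + s) 0 ↔ (r = 1 ∧ s = 1) ∨ (r ≠ s ∧ P) := by
  have h : (2 * a + r).testBit 0 ≠ (2 * b + s).testBit 0 ↔ r ≠ s := by
    rw [ne_eq, Bool.eq_iff_iff, testBit_two_mul_add_zero a hr, testBit_two_mul_add_zero b hs]
    omega
  rw [CarryFrom, testBit_two_mul_add_zero a hr, testBit_two_mul_add_zero b hs, h]

theorem carryFrom_two_mul_add_succ (P : Prop) (a b i : ℕ) {r s : ℕ} (hr : r < 2) (hs : s < 2) :
    CarryFrom P (2 * a + r) (2 * b + s) (i + 1) ↔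
      CarryFrom (CarryFrom P (2 * a + r) (2 * b + s) 0) a b i := by
  induction i with
  | zero =>
    rw [carryFrom_succ, testBit_two_mul_add_succ a 0 hr, testBit_two_mul_add_succ b 0 hs]
    rfl
  | succ i ih =>
    rw [carryFrom_succ, testBit_two_mul_add_succ a _ hr, testBit_two_mul_add_succ b _ hs, ih]
    rfl

/-- All carries of `a + b`, with a carry-in if `P` holds, are forced. -/
def AllForced (P : Prop) (a b : ℕ) : Prop :=
  ∀ i, CarryFrom P a b i → a.testBit i = true ∧ b.testBit i = true

theorem noUnforcedCarries_iff (a b : ℕ) : NoUnforcedCarries a b ↔ AllForced False a b := by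
  simp only [NoUnforcedCarries, AllForced, carry_iff_carryFrom]

theorem allForced_two_mul_add (P : Prop) (a b : ℕ) {r s : ℕ} (hr : r < 2) (hs : s < 2) :
    AllForced P (2 * a + r) (2 * b + s) ↔
      ((r ≠ s ∧ P) → False) ∧ AllForced ((r = 1 ∧ s = 1) ∨ (r ≠ s ∧ P)) a b := by
  have h0 := carryFrom_two_mul_add_zero P a b hr hs
  have h1 : ∀ i, CarryFrom P (2 * a + r) (2 * b + s) (i + 1) ↔
      CarryFrom ((r = 1 ∧ s = 1) ∨ (r ≠ s ∧ P)) a b i := fun i => by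
    rw [carryFrom_two_mul_add_succ P a b i hr hs, h0]
  constructor
  · intro h
    refine ⟨fun hP => ?_, fun i hi => ?_⟩
    · have := h 0 (h0.2 (Or.inr hP))
      rw [testBit_two_mul_add_zero a hr, testBit_two_mul_add_zero b hs] at this
      omega
    · have := h (i + 1) ((h1 i).2 hi)
      rwa [testBit_two_mul_add_succ a i hr, testBit_two_mul_add_succ b i hs] at this
  · rintro ⟨h, h'⟩ i hi
    cases i with
    | zero =>
      rw [testBit_two_mul_add_zero a hr, testBit_two_mul_add_zero b hs]
      rcases h0.1 hi with h2 | h2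
      · exact h2
      · exact (h h2).elim
    | succ i =>
      rw [testBit_two_mul_add_succ a i hr, testBit_two_mul_add_succ b i hs]
      exact h' i ((h1 i).1 hi)

/-- Every carry lowers the digit sum by one, and the common powers count the forced carries. The
carry-in `c` lets the induction strip the last digits. -/
theorem digitSum_add_carry (a b c : ℕ) (hc : c < 2) :
    digitSum (a + b + c) + commonCard a b ≤ digitSum a + digitSum b + c ∧
    (AllForced (c = 1) a b ↔
      digitSum (a + b + c) + commonCard a b = digitSum a + digitSum b + c) := by
  induction hN : a + b using Nat.strong_induction_on generalizing a b c with
  | _ N ih =>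
  subst hN
  rcases Nat.eq_zero_or_pos (a + b) with h | h
  · obtain ⟨rfl, rfl⟩ : a = 0 ∧ b = 0 := by omega
    have h1 : digitSum c = c := by simpa using digitSum_two_mul_add 0 hc
    simp only [commonCard_zero_left, digitSum_zero, zero_add, add_zero, h1, le_refl, true_and,
      iff_true]
    intro i hi
    cases i <;> simp [CarryFrom] at hi
  · obtain ⟨a, r, hr, rfl⟩ := exists_two_mul_add a
    obtain ⟨b, s, hs, rfl⟩ := exists_two_mul_add b
    obtain ⟨d, t, ht, hd⟩ := exists_two_mul_add (r + s + c)
    have hd2 : d < 2 := by omega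
    obtain ⟨h1, h2⟩ := ih (a + b) (by omega) a b d hd2 rfl
    have hsum : 2 * a + r + (2 * b + s) + c = 2 * (a + b + d) + t := by omega
    have hP : ((r = 1 ∧ s = 1) ∨ (r ≠ s ∧ c = 1)) ↔ d = 1 := by omega
    rw [hsum, digitSum_two_mul_add _ ht, digitSum_two_mul_add _ hr, digitSum_two_mul_add _ hs,
      commonCard_two_mul_add a b hr hs, allForced_two_mul_add _ a b hr hs, hP, h2]
    -- `d` is the carry out of the last place and `r * s` its forced part.
    have : r * s ≤ d ∧ (r * s = d ↔ ¬ (r ≠ s ∧ c = 1)) := by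
      interval_cases r <;> interval_cases s <;> omega
    obtain ⟨e, he⟩ : ∃ e, e = r * s := ⟨_, rfl⟩
    rw [← he] at this ⊢
    by_cases hu : r ≠ s ∧ c = 1
    · have hne : e ≠ d := fun h => this.2.1 h hu
      exact ⟨by omega, fun h => (h.1 hu).elim, fun h => by omega⟩
    · simp only [hu, false_imp_iff, true_and, not_false_eq_true, iff_true] at this ⊢
      omega

theorem digitSum_add_add_commonCard_le (a b : ℕ) :
    digitSum (a + b) + commonCard a b ≤ digitSum a + digitSum b :=
  (digitSum_add_carry a b 0 two_pos).1

theorem noUnforcedCarries_iff_digitSum (a b : ℕ) : NoUnforcedCarries a b ↔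
    digitSum (a + b) + commonCard a b = digitSum a + digitSum b := by
  rw [noUnforcedCarries_iff]
  simpa using (digitSum_add_carry a b 0 two_pos).2

theorem digitSum_add_le (a b : ℕ) : digitSum (a + b) ≤ digitSum a + digitSum b :=
  (Nat.le_add_right _ _).trans (digitSum_add_add_commonCard_le a b)

theorem two_pow_digitSum_le (m : ℕ) : 2 ^ digitSum m ≤ m + 1 := by
  induction m using Nat.strong_induction_on with
  | _ m ih =>
  rcases Nat.eq_zero_or_pos m with rfl | h
  · simp
  · obtain ⟨q, r, hr, rfl⟩ := exists_two_mul_add m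
    have := ih q (by omega)
    rw [digitSum_two_mul_add q hr]
    interval_cases r
    · rw [add_zero]; omega
    · rw [pow_succ]; omega

/-- Adding a single power of two turns only one digit 0 into 1, and `q` is a sum of `digitSum q`
such powers. -/
theorem commonCard_add_carry_le (a p q c : ℕ) (hc : c < 2) :
    commonCard a (p + q + c) ≤ commonCard a p + digitSum q + c := by
  induction a using Nat.strong_induction_on generalizing p q c with
  | _ a ih =>
  rcases Nat.eq_zero_or_pos a with rfl | h
  · simp
  · obtain ⟨a, r, hr, rfl⟩ := exists_two_mul_add a
    obtain ⟨p, s, hs, rfl⟩ := exists_two_mul_add p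
    obtain ⟨q, t, ht, rfl⟩ := exists_two_mul_add q
    obtain ⟨d, u, hu, hd⟩ := exists_two_mul_add (s + t + c)
    have h1 := ih a (by omega) p q d (by omega)
    have hsum : 2 * p + s + (2 * q + t) + c = 2 * (p + q + d) + u := by omega
    rw [hsum, digitSum_two_mul_add _ ht, commonCard_two_mul_add _ _ hr hu,
      commonCard_two_mul_add _ _ hr hs]
    interval_cases r <;> omega

theorem commonCard_add_le (a p q : ℕ) : commonCard a (p + q) ≤ commonCard a p + digitSum q :=
  commonCard_add_carry_le a p q 0 two_pos

theorem commonCard_add_one_le (a p : ℕ) : commonCard a (p + 1) ≤ commonCard a p + 1 := by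
  simpa using commonCard_add_carry_le a p 0 1 one_lt_two

/-! ### Valuations and lowest exponents -/

theorem nu_two_mul_add_one (a : ℕ) : nu (2 * a + 1) = (0 : ℤ) := by
  rw [nu, if_neg (by omega), padicValNat.eq_zero_of_not_dvd (by omega)]; rfl

theorem nu_of_ne_zero {m : ℕ} (h : m ≠ 0) : nu m = ((padicValNat 2 m : ℤ) : WithTop ℤ) :=
  if_neg h

theorem nu_eq_coe_iff {m : ℕ} {z : ℤ} : nu m = (z : WithTop ℤ) ↔ m ≠ 0 ∧ (padicValNat 2 m : ℤ) = z := by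
  by_cases h : m = 0
  · simp [h, nu]
  · rw [nu_of_ne_zero h, WithTop.coe_inj]; simp [h]

theorem padicValNat_two_mul {a : ℕ} (h : a ≠ 0) : padicValNat 2 (2 * a) = padicValNat 2 a + 1 := by
  rw [padicValNat.mul two_ne_zero h, padicValNat_self, add_comm]

theorem nu_two_mul_eq_iff (a b : ℕ) : nu (2 * a) = nu (2 * b) ↔ nu a = nu b := by
  rcases eq_or_ne a 0 with rfl | ha <;> rcases eq_or_ne b 0 with rfl | hb
  · simp
  · rw [nu_of_ne_zero hb, nu_of_ne_zero (m := 2 * b) (by omega)]; simp [nu]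
  · rw [nu_of_ne_zero ha, nu_of_ne_zero (m := 2 * a) (by omega)]; simp [nu]
  · rw [nu_of_ne_zero ha, nu_of_ne_zero hb, nu_of_ne_zero (by omega), nu_of_ne_zero (by omega),
      padicValNat_two_mul ha, padicValNat_two_mul hb]
    simp

theorem nu_two_mul_ne (a b : ℕ) : nu (2 * a) ≠ nu (2 * b + 1) := by
  rw [nu_two_mul_add_one, ne_eq, nu_eq_coe_iff]
  rintro ⟨h, h'⟩
  rw [padicValNat_two_mul (by omega)] at h'
  omega

/-- Passing from `m` to `m + 1` creates the power with exponent ν(m+1) and destroys all smaller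
ones. The count grows iff `n` contains the new power and none of those destroyed. -/
theorem commonCard_succ_eq_iff (n m : ℕ) :
    commonCard n (m + 1) = commonCard n m + 1 ↔ nu n = nu (m + 1) := by
  induction n using Nat.strong_induction_on generalizing m with
  | _ n ih =>
  rcases Nat.eq_zero_or_pos n with rfl | h
  · rw [nu_of_ne_zero (Nat.succ_ne_zero m)]; simp [nu]
  · obtain ⟨n, r, hr, rfl⟩ := exists_two_mul_add n
    obtain ⟨m, s, hs, rfl⟩ := exists_two_mul_add m
    rw [commonCard_two_mul_add n m hr hs]
    interval_cases s
    · rw [add_zero, commonCard_two_mul_add n m hr one_lt_two]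
      interval_cases r
      · simpa using nu_two_mul_ne n m
      · simp [nu_two_mul_add_one]
    · have h1 : 2 * m + 1 + 1 = 2 * (m + 1) + 0 := by ring
      rw [h1, commonCard_two_mul_add n (m + 1) hr two_pos]
      interval_cases r
      · simpa [nu_two_mul_eq_iff] using ih n (by omega) m
      · have := commonCard_add_one_le n m
        have h2 := (nu_two_mul_ne (m + 1) n).symm
        simp only [add_zero]
        constructor
        · intro; omega
        · intro h3; exact absurd h3 h2

theorem isLeast_testBit_iff (m e : ℕ) :
    (m.testBit e = true ∧ ∀ i < e, m.testBit i = false) ↔ nu m = ((e : ℤ) : WithTop ℤ) := by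
  induction e generalizing m with
  | zero =>
    obtain ⟨m, r, hr, rfl⟩ := exists_two_mul_add m
    rw [testBit_two_mul_add_zero m hr]
    interval_cases r
    · have := nu_two_mul_ne m 0
      rw [nu_two_mul_add_one] at this
      simpa using this
    · simpa using nu_two_mul_add_one m
  | succ e ih =>
    obtain ⟨m, r, hr, rfl⟩ := exists_two_mul_add m
    rw [testBit_two_mul_add_succ m e hr]
    interval_cases r
    · have h1 : (∀ i < e + 1, (2 * m + 0).testBit i = false) ↔ ∀ i < e, m.testBit i = false := by
        constructor
        · intro h i hi
          rw [← testBit_two_mul_add_succ m i two_pos]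
          exact h _ (by omega)
        · intro h i hi
          cases i with
          | zero => simp
          | succ i => rw [testBit_two_mul_add_succ m i two_pos]; exact h i (by omega)
      rw [h1, ih, nu_eq_coe_iff, nu_eq_coe_iff, add_zero]
      rcases eq_or_ne m 0 with rfl | hm
      · simp
      · rw [padicValNat_two_mul hm]
        push_cast
        constructor <;> rintro ⟨-, h⟩ <;> exact ⟨by omega, by omega⟩
    · rw [nu_two_mul_add_one]
      constructor
      · rintro ⟨-, h⟩
        simpa using h 0 (by omega)
      · intro h
        rw [WithTop.coe_inj] at h
        omega

theorem two_pow_mem_pows (m i : ℕ) : 2 ^ i ∈ pows m ↔ m.testBit i = true := by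
  rw [mem_pows]
  exact ⟨fun ⟨j, hj, h⟩ => Nat.pow_right_injective le_rfl h ▸ hj, fun h => ⟨i, h, rfl⟩⟩

theorem isLeastPosExponent_iff (m e : ℕ) {r : ℕ} (hr : r < 2) :
    IsLeastPosExponent (2 * m + r) e ↔ ∃ d : ℕ, e = d + 1 ∧ nu m = ((d : ℤ) : WithTop ℤ) := by
  simp only [IsLeastPosExponent, two_pow_mem_pows, ← isLeast_testBit_iff]
  constructor
  · rintro ⟨⟨h0, h1⟩, h2⟩
    obtain ⟨d, rfl⟩ : ∃ d, e = d + 1 := ⟨e - 1, by omega⟩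
    rw [testBit_two_mul_add_succ m d hr] at h1
    refine ⟨d, rfl, h1, fun i hi => ?_⟩
    by_contra h
    have : d + 1 ≤ i + 1 := h2 ⟨Nat.succ_pos i, by
      rw [testBit_two_mul_add_succ m i hr]; simpa using h⟩
    omega
  · rintro ⟨d, rfl, h1, h2⟩
    refine ⟨⟨Nat.succ_pos d, by rwa [testBit_two_mul_add_succ m d hr]⟩, ?_⟩
    rintro i ⟨hi, h⟩
    obtain ⟨i, rfl⟩ : ∃ j, i = j + 1 := ⟨i - 1, by omega⟩
    rw [testBit_two_mul_add_succ m i hr] at h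
    by_contra h'
    rw [h2 i (by omega)] at h
    exact absurd h (by simp)

/-- Dropping the last digit turns least positive exponents into valuations; `b ≠ 0` excludes the
agreement ∞ = ∞. -/
theorem sameLeastPosExponent_iff (a b : ℕ) {r s : ℕ} (hr : r < 2) (hs : s < 2) :
    SameLeastPosExponent (2 * a + r) (2 * b + s) ↔ b ≠ 0 ∧ nu a = nu b := by
  simp only [SameLeastPosExponent, isLeastPosExponent_iff _ _ hr, isLeastPosExponent_iff _ _ hs]
  constructor
  · rintro ⟨e, ⟨d, rfl, h⟩, ⟨d', h', h''⟩⟩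
    obtain rfl : d = d' := by omega
    exact ⟨(nu_eq_coe_iff.1 h'').1, h.trans h''.symm⟩
  · rintro ⟨h, h'⟩
    rw [nu_of_ne_zero h] at h'
    exact ⟨_, ⟨_, rfl, h'⟩, ⟨_, rfl, nu_of_ne_zero h⟩⟩

/-! ### Carries and the valuation of binomial coefficients -/

theorem padicValNat_choose_add (a b : ℕ) :
    padicValNat 2 ((a + b).choose a) + digitSum (a + b) = digitSum a + digitSum b := by
  have h := sub_one_mul_padicValNat_choose_eq_sub_sum_digits (p := 2) (Nat.le_add_right a b)
  have h2 := digitSum_add_le a b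
  simp only [Nat.add_sub_cancel_left, Nat.add_one_sub_one, one_mul] at h
  rw [h]
  simp only [digitSum] at *
  omega

theorem commonCard_le_padicValNat_choose (a b : ℕ) :
    commonCard a b ≤ padicValNat 2 ((a + b).choose a) := by
  have := padicValNat_choose_add a b
  have := digitSum_add_add_commonCard_le a b
  omega

theorem noUnforcedCarries_iff_padicValNat (a b : ℕ) :
    NoUnforcedCarries a b ↔ padicValNat 2 ((a + b).choose a) = commonCard a b := by
  have := padicValNat_choose_add a b
  rw [noUnforcedCarries_iff_digitSum]
  omega

theorem two_pow_dvd_choose (a b : ℕ) : 2 ^ commonCard a b ∣ (a + b).choose a :=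
  (pow_dvd_pow 2 (commonCard_le_padicValNat_choose a b)).trans pow_padicValNat_dvd

theorem noUnforcedCarries_of_commonCard_eq_zero {a b : ℕ} (h : commonCard a b = 0) :
    NoUnforcedCarries a b := by
  have h0 : ∀ i, ¬ (a.testBit i = true ∧ b.testBit i = true) := fun i hi => by
    rw [commonCard, Finset.card_eq_zero] at h
    have : 2 ^ i ∈ pows a ∩ pows b :=
      Finset.mem_inter.2 ⟨(two_pow_mem_pows a i).2 hi.1, (two_pow_mem_pows b i).2 hi.2⟩
    simp [h] at this
  intro i hi
  exfalso
  induction i with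
  | zero => exact h0 0 hi
  | succ i ih => exact hi.elim (h0 _) fun h => ih h.2

open PowerSeries

/-! ### Divisibility by powers of two in the 2-adic integers -/

theorem valuation_natCast (n : ℕ) : (n : ℤ_[2]).valuation = padicValNat 2 n := by
  zify
  rw [← PadicInt.valuation_coe, PadicInt.coe_natCast, Padic.valuation_natCast]
  exact (padicValRat.of_nat).symm

theorem two_pow_dvd_iff {x : ℤ_[2]} (hx : x ≠ 0) (r : ℕ) : 2 ^ r ∣ x ↔ r ≤ x.valuation := by
  have := PadicInt.mem_span_pow_iff_le_valuation x hx r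
  rwa [Ideal.mem_span_singleton, Nat.cast_ofNat] at this

theorem two_pow_dvd_natCast (r n : ℕ) : (2 : ℤ_[2]) ^ r ∣ n ↔ 2 ^ r ∣ n := by
  rcases eq_or_ne n 0 with rfl | hn
  · simp
  · rw [two_pow_dvd_iff (Nat.cast_ne_zero.2 hn), valuation_natCast,
      padicValNat_dvd_iff_le hn]

theorem padicValNat_succ_le (i : ℕ) : 2 ^ padicValNat 2 (i + 1) ≤ i + 1 :=
  Nat.le_of_dvd i.succ_pos pow_padicValNat_dvd

/-- ν(i+1) ≤ i, because 2^ν(i+1) ≤ i+1 ≤ 2^i. This makes log(1+2X)/(2X) integral. -/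
theorem natCast_succ_dvd (i : ℕ) : ((i + 1 : ℕ) : ℤ_[2]) ∣ (-2) ^ i := by
  have h0 : ((i + 1 : ℕ) : ℤ_[2]) ≠ 0 := Nat.cast_ne_zero.2 i.succ_ne_zero
  rw [PadicInt.unitCoeff_spec h0, Units.mul_left_dvd, valuation_natCast, neg_pow, Nat.cast_ofNat]
  refine Dvd.dvd.mul_left (pow_dvd_pow 2 ?_) _
  rw [← Nat.pow_le_pow_iff_right one_lt_two]
  exact (padicValNat_succ_le i).trans Nat.lt_two_pow_self

/-- The coefficient `(-2) ^ i / (i + 1)` of `log (1 + 2X) / (2X)`. -/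
noncomputable def logCoeff (i : ℕ) : ℤ_[2] := (natCast_succ_dvd i).choose

theorem logCoeff_spec (i : ℕ) : ((i + 1 : ℕ) : ℤ_[2]) * logCoeff i = (-2) ^ i :=
  (natCast_succ_dvd i).choose_spec.symm

theorem two_pow_dvd_logCoeff {i r : ℕ} (h : padicValNat 2 (i + 1) + r ≤ i) :
    2 ^ r ∣ logCoeff i := by
  have h2 : (-2 : ℤ_[2]) ^ i ≠ 0 := pow_ne_zero _ (neg_ne_zero.2 two_ne_zero)
  have h0 : logCoeff i ≠ 0 := fun h0 => h2 (by rw [← logCoeff_spec, h0, mul_zero])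
  have h1 : ((i + 1 : ℕ) : ℤ_[2]) ≠ 0 := Nat.cast_ne_zero.2 i.succ_ne_zero
  have h3 := congrArg PadicInt.valuation (logCoeff_spec i)
  have h4 : i ≤ ((-2 : ℤ_[2]) ^ i).valuation := by
    rw [← two_pow_dvd_iff h2, neg_pow]
    exact Dvd.intro_left _ rfl
  rw [PadicInt.valuation_mul h1 h0, valuation_natCast] at h3
  rw [two_pow_dvd_iff h0]
  omega

/-! ### The series `log (1 + 2X) / (2X)` and its powers -/

/-- The power series `log (1 + 2X) / (2X)`. -/
noncomputable def logSeries : ℤ_[2]⟦X⟧ := mk logCoeff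

/-- The power series `2X / log (1 + 2X)`. -/
noncomputable def logInv : ℤ_[2]⟦X⟧ := invOfUnit logSeries 1

/-- The power series `1 / (1 + 2X)`. -/
noncomputable def geom : ℤ_[2]⟦X⟧ := mk fun i => (-2) ^ i

/-- The power series `(1 - log (1 + 2X) / (2X)) / X`. -/
noncomputable def logTail : ℤ_[2]⟦X⟧ := mk fun i => -logCoeff (i + 1)

theorem logCoeff_zero : logCoeff 0 = 1 := by simpa using logCoeff_spec 0

theorem logSeries_mul_logInv : logSeries * logInv = 1 :=
  mul_invOfUnit _ _ (by simp [logSeries, logCoeff_zero])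

theorem logSeries_eq : logSeries = 1 - X * logTail := by
  ext i
  cases i with
  | zero => simp [logSeries, logCoeff_zero]
  | succ i =>
    rw [map_sub, coeff_succ_X_mul, coeff_one, if_neg i.succ_ne_zero]
    simp [logSeries, logTail]

theorem coeff_natCast_mul (k n : ℕ) (f : ℤ_[2]⟦X⟧) : coeff n ((k : ℤ_[2]⟦X⟧) * f) = k * coeff n f := by
  rw [← nsmul_eq_mul, map_nsmul, nsmul_eq_mul]

theorem coeff_two_mul (n : ℕ) (f : ℤ_[2]⟦X⟧) : coeff n (2 * f) = 2 * coeff n f := by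
  simpa using coeff_natCast_mul 2 n f

theorem one_add_two_X_mul_geom : (1 + 2 * X) * geom = 1 := by
  ext i
  rw [add_mul, one_mul, mul_assoc, map_add, coeff_two_mul, coeff_one]
  cases i with
  | zero => simp [geom]
  | succ i =>
    rw [coeff_succ_X_mul, if_neg i.succ_ne_zero]
    simp only [geom, coeff_mk]
    ring

theorem coeff_X_mul_derivative (f : ℤ_[2]⟦X⟧) (m : ℕ) :
    coeff m (X * derivative ℤ_[2] f) = m * coeff m f := by
  cases m with
  | zero => simp
  | succ m => rw [coeff_succ_X_mul, coeff_derivative]; push_cast; ring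

theorem geom_eq : geom = logSeries + X * derivative ℤ_[2] logSeries := by
  ext i
  rw [map_add, coeff_X_mul_derivative]
  simp only [geom, logSeries, coeff_mk]
  rw [← logCoeff_spec]
  push_cast
  ring

/-- `geom` is the derivative of X L, that is L + X L', and (L^(-n))' = -n L^(-n-1) L'. -/
theorem natCast_mul_geom_mul_pow (n : ℕ) :
    (n : ℤ_[2]⟦X⟧) * (geom * logInv ^ (n + 1)) =
      (n : ℤ_[2]⟦X⟧) * logInv ^ n - X * derivative ℤ_[2] (logInv ^ n) := by
  have h := logSeries_mul_logInv
  have hd : derivative ℤ_[2] logInv = -logInv ^ 2 * derivative ℤ_[2] logSeries := by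
    have h1 := congrArg (derivative ℤ_[2]) h
    rw [Derivation.leibniz, derivative_one, smul_eq_mul, smul_eq_mul] at h1
    linear_combination logInv * h1 - derivative ℤ_[2] logInv * h
  cases n with
  | zero => simp
  | succ n =>
    rw [derivative_pow, hd, geom_eq, Nat.add_sub_cancel]
    linear_combination (((n + 1 : ℕ) : ℤ_[2]⟦X⟧) * logInv ^ (n + 1)) * h

theorem natCast_mul_coeff_geom_mul_pow (n m : ℕ) :
    (n : ℤ_[2]) * coeff m (geom * logInv ^ (n + 1)) = (n - m) * coeff m (logInv ^ n) := by
  have h := congrArg (coeff m) (natCast_mul_geom_mul_pow n)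
  rw [map_sub, coeff_X_mul_derivative, coeff_natCast_mul, coeff_natCast_mul] at h
  rw [h]; ring

/-- Inserting 1 = (1+2X) · `geom` gives a recurrence that mirrors that of the Stirling numbers. -/
theorem natCast_mul_coeff_pow (n m : ℕ) :
    (n : ℤ_[2]) * coeff (m + 1) (logInv ^ (n + 1)) =
      (n - (m + 1)) * coeff (m + 1) (logInv ^ n) + 2 * (n - m) * coeff m (logInv ^ n) := by
  have h1 := natCast_mul_coeff_geom_mul_pow n (m + 1)
  have h2 := natCast_mul_coeff_geom_mul_pow n m
  have h3 : logInv ^ (n + 1) =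
      geom * logInv ^ (n + 1) + 2 * (X * (geom * logInv ^ (n + 1))) := by
    linear_combination (-logInv ^ (n + 1)) * one_add_two_X_mul_geom
  have h4 := congrArg (coeff (m + 1)) h3
  rw [map_add, coeff_two_mul, coeff_succ_X_mul] at h4
  rw [h4]
  push_cast at h1
  linear_combination h1 + 2 * h2

/-! ### Stirling numbers as coefficients -/

theorem constantCoeff_logInv_pow (n : ℕ) : coeff 0 (logInv ^ n) = 1 := by
  have h : constantCoeff logInv = (1 : ℤ_[2]) := by simp [logInv]
  simp [h]

open Nat in
theorem stirlingSecond_mul_eq_coeff_pow (m k : ℕ) :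
    (Nat.stirlingSecond (m + k + 1) (k + 1) : ℤ_[2]) * k ! * 2 ^ m =
      (m + k)! * coeff m (logInv ^ (m + k + 1)) := by
  induction hN : m + k generalizing m k with
  | zero =>
    obtain ⟨rfl, rfl⟩ : m = 0 ∧ k = 0 := by omega
    simpa [Nat.stirlingSecond_self] using (constantCoeff_logInv_pow 1).symm
  | succ N ih =>
    rcases m with _ | m
    · obtain rfl : k = N + 1 := by omega
      rw [constantCoeff_logInv_pow]; simp [Nat.stirlingSecond_self]
    · obtain rfl : N = m + k := by omega
      have hrec := natCast_mul_coeff_pow (m + k + 1) m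
      have h1 := ih m k rfl
      rw [Nat.stirlingSecond_succ_succ, Nat.factorial_succ]
      rcases k with _ | k
      -- Here S(m+1,0) = 0, matching the factor n - (m+1) of the recurrence, which vanishes at n =
      -- m+1.
      · simp only [Nat.stirlingSecond_succ_zero, add_zero, zero_add] at *
        push_cast at *
        linear_combination 2 * h1 - (m ! : ℤ_[2]) * hrec
      · have h2 := ih (m + 1) k (by omega)
        rw [Nat.factorial_succ k] at *
        have e : m + (k + 1) + 1 = m + k + 1 + 1 := by ring
        have e' : m + (k + 1) = m + k + 1 := by ring
        rw [e'] at *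
        push_cast at *
        linear_combination 2 * (k + 1 + 1 : ℤ_[2]) * h1 + (k + 1 : ℤ_[2]) * h2 -
          ((m + k + 1)! : ℤ_[2]) * hrec

open Nat in
theorem stirlingSecond_mul_eq_coeff_geom (m k : ℕ) :
    (Nat.stirlingSecond (m + k + 1) (k + 1) : ℤ_[2]) * (k + 1)! * 2 ^ m =
      (m + k + 1)! * coeff m (geom * logInv ^ (m + k + 1 + 1)) := by
  have h1 := stirlingSecond_mul_eq_coeff_pow m k
  have h2 := natCast_mul_coeff_geom_mul_pow (m + k + 1) m
  rw [Nat.factorial_succ k, Nat.factorial_succ (m + k)]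
  push_cast at *
  linear_combination (k + 1 : ℤ_[2]) * h1 - ((m + k)! : ℤ_[2]) * h2

/-! ### Expansion of the coefficients in binomial coefficients -/

theorem one_sub_mul_sum_choose {R : Type*} [CommRing R] (y : R) (n M : ℕ) :
    (1 - y) * ∑ p ∈ Finset.range M, ((n + 1 + p).choose (n + 1) : R) * y ^ p =
      ∑ p ∈ Finset.range M, ((n + p).choose n : R) * y ^ p - (n + M).choose (n + 1) * y ^ M := by
  induction M with
  | zero => simp
  | succ M ih =>
    have h1 : (n + 1 + M).choose (n + 1) = (n + M).choose n + (n + M).choose (n + 1) := by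
      rw [add_right_comm, Nat.choose_succ_succ]
    rw [Finset.sum_range_succ, Finset.sum_range_succ, mul_add, ih, ← add_assoc,
      add_right_comm n M 1, h1]
    push_cast
    ring

/-- The negative binomial series truncated modulo y^M; with y = X T and M = m+1 the remainder does
not reach the coefficient of X^m. -/
theorem exists_one_sub_pow_mul_sum_choose {R : Type*} [CommRing R] (y : R) (n M : ℕ) :
    ∃ q, (1 - y) ^ (n + 1) * ∑ p ∈ Finset.range M, ((n + p).choose n : R) * y ^ p =
      1 + y ^ M * q := by
  induction n with
  | zero =>
    refine ⟨-1, ?_⟩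
    simp only [zero_add, pow_one, Nat.choose_zero_right, Nat.cast_one, one_mul, mul_neg_geom_sum]
    ring
  | succ n ih =>
    obtain ⟨q, hq⟩ := ih
    refine ⟨q - (1 - y) ^ (n + 1) * (n + M).choose (n + 1), ?_⟩
    rw [pow_succ, mul_assoc, one_sub_mul_sum_choose, mul_sub, hq]
    ring

theorem coeff_mul_logInv_pow (W : ℤ_[2]⟦X⟧) (n m : ℕ) :
    coeff m (W * logInv ^ (n + 1)) =
      ∑ p ∈ Finset.range (m + 1), ((n + p).choose n : ℤ_[2]) * coeff (m - p) (W * logTail ^ p) := by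
  obtain ⟨q, hq⟩ := exists_one_sub_pow_mul_sum_choose (X * logTail) n (m + 1)
  rw [← logSeries_eq] at hq
  have h1 : logSeries ^ (n + 1) * logInv ^ (n + 1) = 1 := by
    rw [← mul_pow, logSeries_mul_logInv, one_pow]
  have h2 : W * logInv ^ (n + 1) =
      ∑ p ∈ Finset.range (m + 1), ((n + p).choose n : ℤ_[2]⟦X⟧) * (X ^ p * (W * logTail ^ p)) -
        X ^ (m + 1) * (W * logInv ^ (n + 1) * logTail ^ (m + 1) * q) := by
    have h3 : ∑ p ∈ Finset.range (m + 1),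
          ((n + p).choose n : ℤ_[2]⟦X⟧) * (X ^ p * (W * logTail ^ p)) =
        W * ∑ p ∈ Finset.range (m + 1), ((n + p).choose n : ℤ_[2]⟦X⟧) * (X * logTail) ^ p := by
      rw [Finset.mul_sum]
      exact Finset.sum_congr rfl fun p _ => by rw [mul_pow]; ring
    rw [h3]
    linear_combination (-W * logInv ^ (n + 1)) * hq + (W * ∑ p ∈ Finset.range (m + 1),
      ((n + p).choose n : ℤ_[2]⟦X⟧) * (X * logTail) ^ p) * h1
  rw [h2, map_sub, map_sum, coeff_X_pow_mul', if_neg (by omega), sub_zero]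
  refine Finset.sum_congr rfl fun p hp => ?_
  rw [coeff_natCast_mul, coeff_X_pow_mul', if_pos (by simpa [Nat.lt_succ_iff] using hp)]

/-! ### Series whose `i`-th coefficient is divisible by `2 ^ digitSum i` -/

/-- The coefficient of `X ^ i` is divisible by `2 ^ (digitSum i + r)`. -/
def DigitDvd (r : ℕ) (f : ℤ_[2]⟦X⟧) : Prop := ∀ i, 2 ^ (digitSum i + r) ∣ coeff i f

theorem DigitDvd.add {r : ℕ} {f g : ℤ_[2]⟦X⟧} (hf : DigitDvd r f) (hg : DigitDvd r g) :
    DigitDvd r (f + g) := fun i => by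
  rw [map_add]; exact dvd_add (hf i) (hg i)

theorem DigitDvd.mono {r s : ℕ} {f : ℤ_[2]⟦X⟧} (hf : DigitDvd s f) (h : r ≤ s) : DigitDvd r f :=
  fun i => (pow_dvd_pow 2 (by omega)).trans (hf i)

/-- Rests on the subadditivity of σ. -/
theorem DigitDvd.mul {r s : ℕ} {f g : ℤ_[2]⟦X⟧} (hf : DigitDvd r f) (hg : DigitDvd s g) :
    DigitDvd (r + s) (f * g) := fun i => by
  rw [coeff_mul]
  refine Finset.dvd_sum fun ⟨a, b⟩ hab => ?_
  obtain rfl : a + b = i := Finset.HasAntidiagonal.mem_antidiagonal.1 hab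
  have h := mul_dvd_mul (hf a) (hg b)
  rw [← pow_add] at h
  refine (pow_dvd_pow 2 ?_).trans h
  have := digitSum_add_le a b
  omega

theorem digitDvd_natCast_mul_X_pow {r c d : ℕ} (h : 2 ^ (digitSum d + r) ∣ c) :
    DigitDvd r ((c : ℤ_[2]⟦X⟧) * X ^ d) := fun i => by
  rw [coeff_natCast_mul, coeff_X_pow]
  split_ifs with hi
  · rw [hi, mul_one, two_pow_dvd_natCast]; exact h
  · simp

theorem digitSum_one : digitSum 1 = 1 := by simp [digitSum]

theorem digitSum_two : digitSum 2 = 1 := by simp [digitSum]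

theorem digitSum_three : digitSum 3 = 2 := by simp [digitSum]

theorem digitSum_four : digitSum 4 = 1 := by simp [digitSum]

theorem digitDvd_one : DigitDvd 0 1 := by
  simpa using digitDvd_natCast_mul_X_pow (r := 0) (c := 1) (d := 0) (by simp)

theorem digitDvd_two_X : DigitDvd 0 (2 * X) := by
  simpa using digitDvd_natCast_mul_X_pow (r := 0) (c := 2) (d := 1) (by simp [digitSum_one])

theorem digitDvd_two_mul_X_sq (p : ℕ) : DigitDvd 0 (2 * (p : ℤ_[2]⟦X⟧) * X ^ 2) := by
  simpa using digitDvd_natCast_mul_X_pow (r := 0) (c := 2 * p) (d := 2) (by simp [digitSum_two])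

theorem digitDvd_four_mul_X_pow_four (p : ℕ) : DigitDvd 1 (4 * (p : ℤ_[2]⟦X⟧) * X ^ 4) := by
  simpa using digitDvd_natCast_mul_X_pow (r := 1) (c := 4 * p) (d := 4)
    (by simp [digitSum_four])

/-- For i ≥ 2, σ(i) < i leaves a factor 2 to spare; at i = 1 the difference is -4. -/
theorem digitDvd_geom_sub : DigitDvd 1 (geom - (1 + 2 * X)) := fun i => by
  have h0 : coeff i (geom - (1 + 2 * X)) =
      (-2) ^ i - ((if i = 0 then 1 else 0) + 2 * if i = 1 then 1 else 0) := by
    rw [map_sub, map_add, coeff_two_mul, coeff_one, coeff_X]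
    simp only [geom, coeff_mk]
  rw [h0]
  rcases i with _ | _ | i
  · simp
  · exact ⟨-1, by norm_num [digitSum_one]⟩
  · have h1 : digitSum (i + 2) < i + 2 := by
      rw [← Nat.pow_lt_pow_iff_right one_lt_two]
      refine (two_pow_digitSum_le _).trans_lt ?_
      have : i < 2 ^ i := Nat.lt_two_pow_self
      rw [pow_add]; omega
    rw [if_neg (by omega), if_neg (by omega), mul_zero, add_zero, sub_zero, neg_pow]
    exact (pow_dvd_pow 2 h1).mul_left _

/-- The X^i coefficient of T is -(-2)^(i+1)/(i+2). Its valuation i + 1 - ν(i+2) exceeds σ(i) except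
at i = 0 and i = 2, where the coefficients are 1 and 2. -/
theorem digitDvd_logTail_sub : DigitDvd 1 (logTail - (1 + 2 * X ^ 2)) := fun i => by
  have h0 : coeff i (logTail - (1 + 2 * X ^ 2)) =
      -logCoeff (i + 1) - ((if i = 0 then 1 else 0) + 2 * if i = 2 then 1 else 0) := by
    rw [map_sub, map_add, coeff_two_mul, coeff_one, coeff_X_pow]
    simp only [logTail, coeff_mk]
  rw [h0]
  by_cases hi0 : i = 0
  · subst hi0
    have h1 : logCoeff (0 + 1) = -1 := by
      have := logCoeff_spec 1
      have h2 : (2 : ℤ_[2]) * (logCoeff 1 + 1) = 0 := by push_cast at this; linear_combination this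
      have := (mul_eq_zero.1 h2).resolve_left two_ne_zero
      linear_combination this
    rw [h1]; simp
  by_cases hi2 : i = 2
  · subst hi2
    have h1 : logCoeff (2 + 1) = -2 := by
      have := logCoeff_spec 3
      have h2 : (4 : ℤ_[2]) * (logCoeff 3 + 2) = 0 := by push_cast at this; linear_combination this
      have := (mul_eq_zero.1 h2).resolve_left (by exact_mod_cast (by norm_num : (4 : ℕ) ≠ 0))
      linear_combination this
    rw [h1]; simp
  rw [if_neg hi0, if_neg hi2, mul_zero, add_zero, sub_zero, dvd_neg]
  apply two_pow_dvd_logCoeff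
  by_cases hi : i ≤ 3
  · interval_cases i
    · omega
    · rw [padicValNat.eq_zero_of_not_dvd (by norm_num), digitSum_one]
    · omega
    · rw [padicValNat.eq_zero_of_not_dvd (by norm_num), digitSum_three]; norm_num
  · have h1 : padicValNat 2 (i + 1 + 1) + digitSum i < i + 1 := by
      rw [← Nat.pow_lt_pow_iff_right one_lt_two, pow_add]
      -- It remains that (i+2)(i+1) < 2^(i+1), which holds from i = 4 on.
      refine (Nat.mul_le_mul (padicValNat_succ_le (i + 1)) (two_pow_digitSum_le i)).trans_lt ?_
      obtain ⟨j, rfl⟩ : ∃ j, i = j + 4 := ⟨i - 4, by omega⟩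
      clear h0 hi0 hi2 hi
      induction j with
      | zero => norm_num
      | succ j ih => rw [pow_succ]; nlinarith
    omega

/-- Multiplying 1 + 2pX^2 by 1 + 2X^2 leaves the cross term 4pX^4, negligible because σ(4) + 1 = 2.
-/
theorem digitDvd_logTail_pow_sub (p : ℕ) :
    DigitDvd 1 (logTail ^ p - (1 + 2 * (p : ℤ_[2]⟦X⟧) * X ^ 2)) := by
  induction p with
  | zero => intro i; simp
  | succ p ih =>
    have h1 := digitDvd_logTail_sub
    have h2 : DigitDvd 0 (1 + 2 * X ^ 2) :=
      digitDvd_one.add (by simpa using digitDvd_two_mul_X_sq 1)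
    have h3 : DigitDvd 0 (1 + 2 * (p : ℤ_[2]⟦X⟧) * X ^ 2) := digitDvd_one.add (digitDvd_two_mul_X_sq p)
    have h4 := ((ih.mul h2).add (h1.mul h3)).add
      ((digitDvd_four_mul_X_pow_four p).add ((ih.mul h1).mono (by omega)))
    convert h4 using 1
    push_cast
    ring

theorem digitDvd_geom_mul_logTail_pow_sub (p : ℕ) :
    DigitDvd 1 (geom * logTail ^ p - (1 + 2 * X) * (1 + 2 * (p : ℤ_[2]⟦X⟧) * X ^ 2)) := by
  have h1 : DigitDvd 0 (1 + 2 * X) := digitDvd_one.add digitDvd_two_X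
  have h2 : DigitDvd 0 (1 + 2 * (p : ℤ_[2]⟦X⟧) * X ^ 2) := digitDvd_one.add (digitDvd_two_mul_X_sq p)
  have h3 := digitDvd_geom_sub
  have h4 := digitDvd_logTail_pow_sub p
  have h5 := ((h3.mul h2).add (h1.mul h4)).add
    ((h3.mul h4).mono (by omega))
  convert h5 using 1
  ring

theorem two_pow_dvd_sum_choose {F : ℕ → ℤ_[2]⟦X⟧} (hF : ∀ p, DigitDvd 1 (F p)) (n m : ℕ) :
    2 ^ (commonCard n m + 1) ∣
      ∑ p ∈ Finset.range (m + 1), ((n + p).choose n : ℤ_[2]) * coeff (m - p) (F p) := by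
  refine Finset.dvd_sum fun p hp => ?_
  rw [Finset.mem_range] at hp
  have h1 : (2 : ℤ_[2]) ^ commonCard n p ∣ ((n + p).choose n : ℤ_[2]) :=
    (two_pow_dvd_natCast _ _).2 (two_pow_dvd_choose n p)
  have h2 := mul_dvd_mul h1 (hF p (m - p))
  rw [← pow_add] at h2
  refine (pow_dvd_pow 2 ?_).trans h2
  have := commonCard_add_le n p (m - p)
  rw [Nat.add_sub_cancel' (by omega)] at this
  omega

/-- From 1 + 2pX^2 only p = m and p = m - 2 reach X^m. For m < 2 the truncated factor `m - 2`
removes the second term. -/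
theorem two_pow_dvd_coeff_pow_sub (n m : ℕ) :
    (2 : ℤ_[2]) ^ (commonCard n m + 1) ∣ coeff m (logInv ^ (n + 1)) -
      ((n + m).choose n + 2 * ((m - 2) * (n + m - 2).choose n) : ℕ) := by
  have h := two_pow_dvd_sum_choose digitDvd_logTail_pow_sub n m
  have e := coeff_mul_logInv_pow 1 n m
  simp only [one_mul] at e
  simp only [map_sub, mul_sub, Finset.sum_sub_distrib, ← e] at h
  convert h using 2
  have hc : ∀ (p : ℕ) i, coeff i (1 + 2 * (p : ℤ_[2]⟦X⟧) * X ^ 2) =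
      (if i = 0 then 1 else 0) + 2 * ((p : ℤ_[2]) * if i = 2 then 1 else 0) := fun p i => by
    rw [map_add, mul_assoc, coeff_two_mul, coeff_natCast_mul, coeff_one, coeff_X_pow]
  simp only [hc]
  rcases m with _ | _ | m
  · simp
  · simp [Finset.sum_range_succ]
  · rw [Finset.sum_range_succ, Finset.sum_range_succ, Finset.sum_range_succ, Finset.sum_eq_zero]
    · have e1 : m + 1 + 1 - m = 2 := by omega
      have e2 : m + 1 + 1 - (m + 1) = 1 := by omega
      have e3 : n + (m + 1 + 1) - 2 = n + m := by omega
      rw [e1, e2, e3, Nat.sub_self]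
      push_cast
      norm_num
      ring
    · intro p hp
      rw [Finset.mem_range] at hp
      rw [if_neg (by omega), if_neg (by omega)]; ring

theorem two_pow_dvd_coeff_geom_sub (n m : ℕ) (hn : n ≠ 0) :
    (2 : ℤ_[2]) ^ (commonCard n m + 1) ∣ coeff m (geom * logInv ^ (n + 1)) -
      ((n + m).choose n + 2 * (n + m - 1).choose n + 2 * ((m - 2) * (n + m - 2).choose n) +
        4 * ((m - 3) * (n + m - 3).choose n) : ℕ) := by
  have h := two_pow_dvd_sum_choose digitDvd_geom_mul_logTail_pow_sub n m
  have e := coeff_mul_logInv_pow geom n m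
  simp only [map_sub, mul_sub, Finset.sum_sub_distrib, ← e] at h
  convert h using 2
  have hc : ∀ (p : ℕ) i, coeff i ((1 + 2 * X) * (1 + 2 * (p : ℤ_[2]⟦X⟧) * X ^ 2)) =
      (if i = 0 then 1 else 0) + 2 * (if i = 1 then 1 else 0) +
        2 * ((p : ℤ_[2]) * if i = 2 then 1 else 0) + 2 * (2 * ((p : ℤ_[2]) * if i = 3 then 1 else 0)) := fun p i => by
    have : (1 + 2 * X) * (1 + 2 * (p : ℤ_[2]⟦X⟧) * X ^ 2) =
        1 + 2 * X + 2 * ((p : ℤ_[2]⟦X⟧) * X ^ 2) + 2 * (2 * ((p : ℤ_[2]⟦X⟧) * X ^ 3)) := by ring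
    rw [this]
    simp only [map_add, coeff_two_mul, coeff_natCast_mul, coeff_one, coeff_X_pow, coeff_X]
  simp only [hc]
  -- For m = 0 there is no term p = m - 1, so its binomial must vanish; this needs `n ≠ 0`.
  have e0 : (n - 1).choose n = 0 := Nat.choose_eq_zero_of_lt (by omega)
  rcases m with _ | _ | _ | m
  · simp [e0]
  · simp [Finset.sum_range_succ]; ring
  · simp [Finset.sum_range_succ]; ring
  · rw [Finset.sum_range_succ, Finset.sum_range_succ, Finset.sum_range_succ,
      Finset.sum_range_succ, Finset.sum_eq_zero]
    · have e1 : m + 1 + 1 + 1 - m = 3 := by omega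
      have e2 : m + 1 + 1 + 1 - (m + 1) = 2 := by omega
      have e3 : m + 1 + 1 + 1 - (m + 1 + 1) = 1 := by omega
      have e4 : n + (m + 1 + 1 + 1) - 3 = n + m := by omega
      have e5 : n + (m + 1 + 1 + 1) - 2 = n + (m + 1) := by omega
      have e6 : n + (m + 1 + 1 + 1) - 1 = n + (m + 1 + 1) := by omega
      have e7 : m + 1 + 1 + 1 - 2 = m + 1 := by omega
      have e8 : m + 1 + 1 + 1 - 3 = m := by omega
      rw [e1, e2, e3, e4, e5, e6, e7, Nat.sub_self]
      push_cast
      norm_num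
      ring
    · intro p hp
      rw [Finset.mem_range] at hp
      rw [if_neg (by omega), if_neg (by omega), if_neg (by omega), if_neg (by omega)]; ring

/-! ### The conditions on binomial coefficients -/

theorem nu_eq_natCast_iff {r x : ℕ} (h : 2 ^ r ∣ x) :
    nu x = ((r : ℤ) : WithTop ℤ) ↔ ¬ 2 ^ (r + 1) ∣ x := by
  rcases eq_or_ne x 0 with rfl | hx
  · simp [nu]
  · rw [padicValNat_dvd_iff_le hx] at h ⊢
    rw [nu_eq_coe_iff, Nat.cast_inj, and_iff_right hx]
    omega

/-- Doubling absorbs the -1; for c = 0 both sides fail. -/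
theorem nu_eq_natCast_sub_one_iff {c x : ℕ} (h : 2 ^ c ∣ 2 * x) :
    nu x = (((c : ℤ) - 1 : ℤ) : WithTop ℤ) ↔ ¬ 2 ^ (c + 1) ∣ 2 * x := by
  rcases c with _ | c
  · rw [nu_eq_coe_iff]
    simp only [zero_add, pow_one, dvd_mul_right, not_true, iff_false, not_and]
    intro _
    omega
  · rw [pow_succ', Nat.mul_dvd_mul_iff_left two_pos] at h ⊢
    rw [← nu_eq_natCast_iff h]
    simp

theorem two_pow_dvd_two_mul_choose_sub_one (n m : ℕ) :
    2 ^ commonCard n m ∣ 2 * (n + m - 1).choose n := by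
  rcases m with _ | m
  · simp
  · have h := mul_dvd_mul_left 2 (two_pow_dvd_choose n m)
    rw [← pow_succ'] at h
    exact (pow_dvd_pow 2 (commonCard_add_one_le n m)).trans h

theorem two_pow_dvd_two_mul_choose_sub_two {n m : ℕ} (h : m = 1 → n ≠ 0) :
    2 ^ commonCard n m ∣ 2 * (n + m - 2).choose n := by
  rcases m with _ | _ | m
  · simp
  · rw [Nat.choose_eq_zero_of_lt (by have := h rfl; omega)]; simp
  · have h := mul_dvd_mul_left 2 (two_pow_dvd_choose n m)
    rw [← pow_succ'] at h
    have h2 := commonCard_add_le n m 2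
    rw [digitSum_two] at h2
    exact (pow_dvd_pow 2 h2).trans h

/-- If q = m - 3 is even, it supplies a further 2, enough since σ(3) = 2. If q is odd, q + 3 is even
and adding 3 amounts to adding 2 to the half, so at most one common power is gained. -/
theorem two_pow_dvd_four_mul_choose_sub_three (n m : ℕ) :
    2 ^ (commonCard n m + 1) ∣ 4 * ((m - 3) * (n + m - 3).choose n) := by
  by_cases hm : m ≤ 3
  · simp [Nat.sub_eq_zero_of_le hm]
  · obtain ⟨q, rfl⟩ : ∃ q, m = q + 3 := ⟨m - 3, by omega⟩
    rw [Nat.add_sub_cancel, ← add_assoc, Nat.add_sub_cancel]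
    have h := two_pow_dvd_choose n q
    obtain ⟨q, s, hs, rfl⟩ := exists_two_mul_add q
    interval_cases s
    · have h1 := commonCard_add_le n (2 * q + 0) 3
      rw [digitSum_three] at h1
      have h2 := mul_dvd_mul (dvd_mul_right 8 q) h
      rw [show (8 : ℕ) = 2 ^ 3 from rfl, ← pow_add] at h2
      have h3 : 4 * ((2 * q + 0) * (n + (2 * q + 0)).choose n) =
          2 ^ 3 * q * (n + (2 * q + 0)).choose n := by ring
      rw [h3]
      exact (pow_dvd_pow 2 (by omega)).trans h2
    · have h1 : commonCard n (2 * q + 1 + 3) ≤ commonCard n (2 * q + 1) + 1 := by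
        obtain ⟨a, r, hr, rfl⟩ := exists_two_mul_add n
        have h2 := commonCard_add_le a q 2
        rw [digitSum_two] at h2
        have h3 : 2 * q + 1 + 3 = 2 * (q + 2) + 0 := by ring
        rw [h3, commonCard_two_mul_add _ _ hr one_lt_two, commonCard_two_mul_add _ _ hr two_pos]
        omega
      have h2 := mul_dvd_mul_left (2 ^ 2) h
      rw [← pow_add] at h2
      have h3 := ((pow_dvd_pow 2 (by omega : commonCard n (2 * q + 1 + 3) + 1 ≤
        2 + commonCard n (2 * q + 1))).trans h2).mul_left (2 * q + 1)
      rwa [mul_left_comm] at h3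

/-- The factor m - 2 is harmless for odd m and gives a surplus 2 for even m. For m = 1, where it
truncates to 0, the binomial vanishes as well. -/
theorem odd_and_nu_choose_sub_two_iff {n m : ℕ} (h : m = 1 → n ≠ 0) :
    (Odd m ∧ nu ((n + m - 2).choose n) = (((commonCard n m : ℤ) - 1 : ℤ) : WithTop ℤ)) ↔
      ¬ 2 ^ (commonCard n m + 1) ∣ 2 * ((m - 2) * (n + m - 2).choose n) := by
  have h0 := two_pow_dvd_two_mul_choose_sub_two h
  rw [nu_eq_natCast_sub_one_iff h0]
  rcases Nat.even_or_odd m with hm | hm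
  · rw [← Nat.not_even_iff_odd]
    simp only [hm, not_true, false_and, false_iff, not_not]
    obtain ⟨t, ht⟩ : ∃ t, m - 2 = 2 * t := by
      obtain ⟨u, hu⟩ := hm
      exact ⟨u - 1, by omega⟩
    have h1 := (mul_dvd_mul_left 2 h0).mul_left t
    rw [← pow_succ'] at h1
    have h2 : 2 * (2 * t * (n + m - 2).choose n) = t * (2 * (2 * (n + m - 2).choose n)) := by ring
    rwa [ht, h2]
  · simp only [hm, true_and, not_iff_not]
    by_cases h1 : m = 1
    · rw [h1, Nat.choose_eq_zero_of_lt (by have := h h1; omega)]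
    · have h2 : Nat.Coprime (2 ^ (commonCard n m + 1)) (m - 2) := by
        refine Nat.Coprime.pow_left _ (Nat.coprime_two_left.2 ?_)
        obtain ⟨u, hu⟩ := hm
        exact ⟨u - 1, by omega⟩
      rw [mul_left_comm, h2.dvd_mul_left]

theorem nu_choose_iff (n m : ℕ) :
    nu ((n + m).choose n) = ((commonCard n m : ℤ) : WithTop ℤ) ↔ NoUnforcedCarries n m := by
  rw [noUnforcedCarries_iff_padicValNat, nu_eq_coe_iff, Nat.cast_inj, and_iff_right]
  exact (Nat.choose_pos (Nat.le_add_right n m)).ne'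

/-- For m > 0 the valuation is at least #([n]∩[m-1]), which is at least #([n]∩[m]) - 1; the
condition says that both bounds are sharp. -/
theorem nu_choose_sub_one_iff {n : ℕ} (hn : n ≠ 0) (m : ℕ) :
    nu ((n + m - 1).choose n) = (((commonCard n m : ℤ) - 1 : ℤ) : WithTop ℤ) ↔
      nu n = nu m ∧ NoUnforcedCarries n (m - 1) := by
  rcases m with _ | m
  · rw [add_zero, Nat.choose_eq_zero_of_lt (by omega), nu_of_ne_zero hn, nu_eq_coe_iff]
    simp [nu]
  · have h0 : (n + m).choose n ≠ 0 := (Nat.choose_pos (Nat.le_add_right n m)).ne'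
    have h1 := commonCard_le_padicValNat_choose n m
    have h2 := commonCard_add_one_le n m
    rw [← commonCard_succ_eq_iff, Nat.add_sub_cancel, noUnforcedCarries_iff_padicValNat,
      ← add_assoc, Nat.add_sub_cancel, nu_eq_coe_iff, and_iff_right h0]
    omega

theorem nu_choose_sub_two_iff {n m : ℕ} (h : m = 1 → n ≠ 0) :
    (Odd m ∧ nu ((n + m - 2).choose n) = (((commonCard n m : ℤ) - 1 : ℤ) : WithTop ℤ)) ↔
      Odd m ∧ SameLeastPosExponent n m ∧ NoUnforcedCarries n (m - 2) := by
  refine and_congr_right fun hm => ?_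
  obtain ⟨q, rfl⟩ := hm
  obtain ⟨a, r, hr, rfl⟩ := exists_two_mul_add n
  rw [sameLeastPosExponent_iff _ _ hr one_lt_two]
  rcases q with _ | q
  · rw [Nat.choose_eq_zero_of_lt (by have := h rfl; omega), nu_eq_coe_iff]
    simp
  -- Both numbers being odd, passing from m - 2 to m adds 1 to the half, so the two sharp bounds are
  -- compared there.
  · have e1 : 2 * (q + 1) + 1 - 2 = 2 * q + 1 := by omega
    have e2 : 2 * a + r + (2 * (q + 1) + 1) - 2 = 2 * a + r + (2 * q + 1) := by omega
    have h0 : (2 * a + r + (2 * q + 1)).choose (2 * a + r) ≠ 0 :=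
      (Nat.choose_pos (Nat.le_add_right _ _)).ne'
    have h1 := commonCard_le_padicValNat_choose (2 * a + r) (2 * q + 1)
    have h2 := commonCard_add_one_le a q
    have h3 := commonCard_two_mul_add a q hr one_lt_two
    have h4 := commonCard_two_mul_add a (q + 1) hr one_lt_two
    rw [← commonCard_succ_eq_iff, e1, e2, noUnforcedCarries_iff_padicValNat, nu_eq_coe_iff,
      and_iff_right h0]
    omega

/-- Makes (b) and (c) incompatible. Both n and m - 2 are odd, so a carry enters place 1; without
unforced carries their digits there agree. But the digits of n and m in place 1 also agree, while
those of m and m - 2 differ. -/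
theorem not_noUnforcedCarries_sub_two {n m : ℕ} (hm : Odd m) (hnu : nu n = nu m)
    (hs : SameLeastPosExponent n m) : ¬ NoUnforcedCarries n (m - 2) := by
  obtain ⟨q, rfl⟩ := hm
  obtain ⟨a, r, hr, rfl⟩ := exists_two_mul_add n
  rw [sameLeastPosExponent_iff _ _ hr one_lt_two] at hs
  obtain rfl : r = 1 := by
    interval_cases r
    · exact absurd hnu (nu_two_mul_ne a q)
    · rfl
  obtain ⟨q, rfl⟩ : ∃ p, q = p + 1 := ⟨q - 1, by omega⟩
  have e : 2 * (q + 1) + 1 - 2 = 2 * q + 1 := by omega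
  rw [e, noUnforcedCarries_iff, allForced_two_mul_add _ _ _ one_lt_two one_lt_two]
  rintro ⟨-, h⟩
  obtain ⟨b, s, hs', rfl⟩ := exists_two_mul_add a
  obtain ⟨p, t, ht, rfl⟩ := exists_two_mul_add q
  rw [allForced_two_mul_add _ _ _ hs' ht] at h
  obtain rfl : s = t := by
    by_contra hne
    exact h.1 ⟨hne, Or.inl ⟨rfl, rfl⟩⟩
  have h2 := hs.2
  interval_cases s
  · exact nu_two_mul_ne _ _ h2
  · exact nu_two_mul_ne (p + 1) b h2.symm

/-! ### Sums of terms divisible by a power of two -/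

theorem two_pow_succ_dvd_iff (c t : ℕ) : 2 ^ (c + 1) ∣ 2 ^ c * t ↔ 2 ∣ t := by
  rw [pow_succ, Nat.mul_dvd_mul_iff_left (by positivity)]

theorem not_two_pow_succ_dvd_add_iff {c x y : ℕ} (hx : 2 ^ c ∣ x) (hy : 2 ^ c ∣ y) :
    ¬ 2 ^ (c + 1) ∣ x + y ↔ Xor (¬ 2 ^ (c + 1) ∣ x) (¬ 2 ^ (c + 1) ∣ y) := by
  obtain ⟨x, rfl⟩ := hx
  obtain ⟨y, rfl⟩ := hy
  rw [← mul_add, two_pow_succ_dvd_iff, two_pow_succ_dvd_iff, two_pow_succ_dvd_iff, Xor]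
  omega

/-- The iterated `Xor` also allows all three, which `h` excludes. -/
theorem exactlyOne_iff {p q r : Prop} (h : ¬ (q ∧ r)) : ExactlyOne p q r ↔ Xor (Xor p q) r := by
  unfold ExactlyOne Xor
  tauto

/-! ### The valuation of the Stirling numbers -/

theorem stirlingSecond_ne_zero {n k : ℕ} (hk : 1 ≤ k) (hkn : k ≤ n) :
    Nat.stirlingSecond n k ≠ 0 := by
  induction n, hkn using Nat.le_induction with
  | base => simp [Nat.stirlingSecond_self]
  | succ n hn ih =>
    rw [Nat.stirlingSecond_succ_left n k (by omega)]
    have := Nat.mul_pos hk (Nat.pos_of_ne_zero ih)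
    omega

open Nat in
theorem padicValNat_factorial_add_digitSum (n : ℕ) : padicValNat 2 n ! + digitSum n = n := by
  have h := sub_one_mul_padicValNat_factorial (p := 2) n
  have h2 := Nat.digit_sum_le 2 n
  rw [Nat.add_one_sub_one, one_mul] at h
  rw [h, digitSum]
  omega

open Nat in
-- Legendre's formula gives ν(S) + k - σ(k) + m = m + k - σ(m+k) + ν(a).
theorem nu_eq_sigma_iff {S m k : ℕ} {a : ℤ_[2]} (hS : S ≠ 0)
    (h : (S : ℤ_[2]) * k ! * 2 ^ m = (m + k)! * a) (c : ℕ) :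
    nu S = ((sigma k - sigma (m + k) + c : ℤ) : WithTop ℤ) ↔ 2 ^ c ∣ a ∧ ¬ 2 ^ (c + 1) ∣ a := by
  have hS' : (S : ℤ_[2]) ≠ 0 := Nat.cast_ne_zero.2 hS
  have hk : ((k ! : ℕ) : ℤ_[2]) ≠ 0 := Nat.cast_ne_zero.2 (Nat.factorial_ne_zero k)
  have hn : (((m + k)! : ℕ) : ℤ_[2]) ≠ 0 := Nat.cast_ne_zero.2 (Nat.factorial_ne_zero _)
  have h2 : (2 : ℤ_[2]) ^ m ≠ 0 := pow_ne_zero _ two_ne_zero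
  have ha : a ≠ 0 := by
    rintro rfl
    rw [mul_zero] at h
    exact mul_ne_zero (mul_ne_zero hS' hk) h2 h
  have hv := congrArg PadicInt.valuation h
  have h3 : (2 : ℤ_[2]).valuation = 1 := by simpa using PadicInt.valuation_p (p := 2)
  rw [PadicInt.valuation_mul (mul_ne_zero hS' hk) h2, PadicInt.valuation_mul hS' hk,
    PadicInt.valuation_mul hn ha, PadicInt.valuation_pow, h3, valuation_natCast,
    valuation_natCast, valuation_natCast] at hv
  have h4 := padicValNat_factorial_add_digitSum k
  have h5 := padicValNat_factorial_add_digitSum (m + k)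
  rw [two_pow_dvd_iff ha, two_pow_dvd_iff ha, nu_eq_coe_iff, and_iff_right hS]
  change (_ = (digitSum k : ℤ) - (digitSum (m + k) : ℤ) + c) ↔ _
  omega

open Nat in
theorem nu_eq_sigma_iff_of_dvd_sub {S m k N c : ℕ} {a : ℤ_[2]} (hS : S ≠ 0)
    (h : (S : ℤ_[2]) * k ! * 2 ^ m = (m + k)! * a) (hN : 2 ^ (c + 1) ∣ a - N) (hc : 2 ^ c ∣ N) :
    (nu S = ((sigma k - sigma (m + k) + c : ℤ) : WithTop ℤ) ↔ ¬ 2 ^ (c + 1) ∣ N) ∧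
    (nu S = ((sigma k - sigma (m + k) : ℤ) : WithTop ℤ) ↔ ¬ 2 ∣ N) := by
  have key : ∀ r ≤ c + 1, (2 : ℤ_[2]) ^ r ∣ a ↔ 2 ^ r ∣ N := fun r hr => by
    rw [← two_pow_dvd_natCast, dvd_iff_dvd_of_dvd_sub ((pow_dvd_pow 2 hr).trans hN)]
  constructor
  · rw [nu_eq_sigma_iff hS h, key c (by omega), key (c + 1) le_rfl, and_iff_right hc]
  · have := nu_eq_sigma_iff hS h 0
    rw [Nat.cast_zero, add_zero, key 0 (by omega), key (0 + 1) (by omega)] at this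
    simpa using this

theorem commonCard_eq_zero_iff (a b : ℕ) : commonCard a b = 0 ↔ pows b ∩ pows a = ∅ := by
  rw [commonCard, Finset.card_eq_zero, Finset.inter_comm]

theorem not_two_dvd_choose_add_iff {n m t : ℕ} (h : 2 ∣ t) :
    ¬ 2 ∣ (n + m).choose n + t ↔ commonCard n m = 0 := by
  rw [(Nat.dvd_add_iff_left h).symm]
  constructor
  · intro h1
    by_contra h2
    exact h1 ((dvd_pow_self 2 h2).trans (two_pow_dvd_choose n m))
  · intro h1
    have h2 := (nu_choose_iff n m).2 (noUnforcedCarries_of_commonCard_eq_zero h1)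
    rw [nu_eq_natCast_iff (two_pow_dvd_choose n m), h1] at h2
    simpa using h2

end StirlingTwo

/-! ### The four criteria -/

open StirlingTwo
theorem theorem3p3 (n k : ℕ) (hk : 1 ≤ k) (hkn : k ≤ n) :
    -- (i) and (ii)
    (IsMZC n k ↔ pows (n - k) ∩ pows n = ∅) ∧
    (IsSMZC n k ↔ pows (n - k) ∩ pows (n - 1) = ∅) ∧
    -- (iii), with the two forms of each of its conditions
    (IsAMZC n k ↔
      pows (n - k) ∩ pows n ≠ ∅ ∧ ExactlyOne (CondA n k) (CondB n k) (CondC n k)) ∧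
    (CondA n k ↔ NoUnforcedCarries n (n - k)) ∧
    (CondB n k ↔ nu n = nu (n - k) ∧ NoUnforcedCarries n (n - k - 1)) ∧
    (CondC n k ↔
      Odd (n - k) ∧ SameLeastPosExponent n (n - k) ∧ NoUnforcedCarries n (n - k - 2)) ∧
    -- (iv), with the two forms of each of its conditions
    (IsSAMZC n k ↔
      pows (n - k) ∩ pows (n - 1) ≠ ∅ ∧ Xor (ShiftedCondA n k) (ShiftedCondB n k)) ∧
    (ShiftedCondA n k ↔ NoUnforcedCarries (n - 1) (n - k)) ∧
    (ShiftedCondB n k ↔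
      Odd (n - k) ∧ SameLeastPosExponent (n - 1) (n - k) ∧
        NoUnforcedCarries (n - 1) (n - k - 2)) := by
  obtain ⟨m, j, rfl, rfl⟩ : ∃ m j, k = j + 1 ∧ n = m + j + 1 :=
    ⟨n - k, k - 1, by omega, by omega⟩
  have e1 : m + j + 1 - (j + 1) = m := by omega
  have e2 : m + j + 1 - 1 = m + j := by omega
  have hS := stirlingSecond_ne_zero (Nat.le_add_left 1 j) hkn
  have hn : m + j + 1 ≠ 0 := by omega
  have hm : m = 1 → m + j ≠ 0 := by omega
  have hm' : m = 1 → m + j + 1 ≠ 0 := fun _ => hn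
  have hA := nu_choose_iff (m + j + 1) m
  have hB := nu_choose_sub_one_iff hn m
  have hC := nu_choose_sub_two_iff hm'
  have hA' := nu_choose_iff (m + j) m
  have hB' := nu_choose_sub_two_iff hm
  have dA := two_pow_dvd_choose (m + j + 1) m
  have dB := two_pow_dvd_two_mul_choose_sub_one (m + j + 1) m
  have dC := (two_pow_dvd_two_mul_choose_sub_two hm').mul_left (m - 2)
  rw [mul_left_comm] at dC
  have dD := two_pow_dvd_four_mul_choose_sub_three (m + j + 1) m
  have dA' := two_pow_dvd_choose (m + j) m
  have dB' := (two_pow_dvd_two_mul_choose_sub_two hm).mul_left (m - 2)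
  rw [mul_left_comm] at dB'
  have hU := nu_eq_sigma_iff_of_dvd_sub hS (stirlingSecond_mul_eq_coeff_geom m j)
    (c := commonCard (m + j + 1) m)
    -- The fourth term of the approximation is divisible by 2^(c+1) and is dropped.
    (by
      have h1 := two_pow_dvd_coeff_geom_sub (m + j + 1) m hn
      have h2 := dvd_add h1 ((two_pow_dvd_natCast _ _).2 dD)
      rw [Nat.cast_add _ (4 * _), ← sub_sub, sub_add_cancel] at h2
      exact h2) (dvd_add (dvd_add dA dB) dC)
  have hV := nu_eq_sigma_iff_of_dvd_sub hS (stirlingSecond_mul_eq_coeff_pow m j)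
    (two_pow_dvd_coeff_pow_sub (m + j) m) (dvd_add dA' dB')
  -- Non-divisibility of the sum by 2^(c+1) becomes the `Xor` of the conditions on its terms.
  rw [add_assoc (Nat.choose _ _), not_two_dvd_choose_add_iff
    (dvd_add (dvd_mul_right 2 _) (dvd_mul_right 2 _)), ← add_assoc (Nat.choose _ _),
    not_two_pow_succ_dvd_add_iff (dvd_add dA dB) dC, not_two_pow_succ_dvd_add_iff dA dB,
    ← nu_eq_natCast_iff dA, ← odd_and_nu_choose_sub_two_iff hm',
    ← nu_eq_natCast_sub_one_iff (two_pow_dvd_two_mul_choose_sub_one (m + j + 1) m)] at hU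
  rw [not_two_dvd_choose_add_iff (dvd_mul_right 2 _),
    not_two_pow_succ_dvd_add_iff dA' dB', ← nu_eq_natCast_iff dA',
    ← odd_and_nu_choose_sub_two_iff hm] at hV
  have hBC : ¬ (CondB (m + j + 1) (j + 1) ∧ CondC (m + j + 1) (j + 1)) := by
    rintro ⟨h1, h2⟩
    simp only [CondB, CondC, e1] at h1 h2
    obtain ⟨h3, h4, h5⟩ := hC.1 h2
    exact not_noUnforcedCarries_sub_two h3 (hB.1 h1).1 h4 h5
  rw [exactlyOne_iff hBC]
  simp only [IsAMZC, IsSAMZC, IsMZC, IsSMZC, CondA, CondB, CondC, ShiftedCondA, ShiftedCondB, e1, e2,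
    Nat.add_sub_cancel, ← commonCard_eq_zero_iff, ne_eq]
  exact ⟨hU.2, hV.2, (and_congr hU.1 (not_congr hU.2)).trans and_comm, hA, hB, hC,
    (and_congr hV.1 (not_congr hV.2)).trans and_comm, hA', hB'⟩
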